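/- **Setting.** Fix $r,\mu,\delta\in\mathbb R$, $\sigma>0$, $S\in(0,\infty)\setminus\{1\}$ and transaction cost parameters $\gamma^\uparrow,\gamma^\downarrow\in[1,\infty)$ with $\xi:=\gamma^\uparrow\gamma^\downarrow$, and put $\lambda:=(\mu-r)/\sigma$. The relative risk aversion $R\in(0,\infty)\setminus\{1\}$ varies subject to $\theta:=\frac{1-R}{1-S}>0$. Put $q_M:=\frac{\lambda}{R\sigma}$, $$m(q):=\frac{\delta}{S}-\frac{1-S}{S}\Big(r+\lambda\sigma q-\frac{q^2\sigma^2}{2}R\Big),\qquad \ell(q):=m(q)+\frac{1-S}{S}\frac{\sigma^2}{2}q(1-q);$$ these depend on $R$, but $m(0)$ does not. *Well-posedness.* Let $\bar\xi:=1$ if $m$ has at most one zero, and $\bar\xi:=\exp\int_{q_-}^{q_+}-\frac{1}{q(1-q)}\frac{m(q)}{\ell(q)}\,dq$ if $m$ has two zeros $q_-<q_+$ (with $\bar\xi:=\infty$ if the integrand is not absolutely integrable). The problem is well-posed for $R$ if $\xi>1$ and either $R<1$, $m(0)>0$, $m(1)>0$, $\xi>\bar\xi$, or $R>1$, $m(q_M)>0$,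 $\xi<\bar\xi$. *Boundaries.* In the well-posed case let $q_*<q^*$ and the continuously differentiable function $n:[q_*,q^*]\to(0,\infty)$ solve the free boundary problem: $0<q_*<q_M<q^*<1$ if $q_M\in(0,1)$; $0<q_*<q^*=1$ if $q_M=1$; $0<q_*<q_M<q^*<2q_M-1$ if $q_M>1$; $2q_M<q_*<q_M<q^*<0$ if $q_M<0$; $n$ is decreasing if $R<1$ and increasing if $R>1$; for $q\in[q_*,q^*]\setminus\{1\}$, $n(q)\ne\ell(q)$ and $n'(q)=\frac{1-S}{S}\frac{n(q)}{1-q}\frac{m(q)-n(q)}{\ell(q)-n(q)}$; $n=m$ at $q_*$ and at $q^*$, and $n'=0$ at each of these two points that is different from $1$; if $1\in[q_*,q^*]$, then $n(1)=m(1)$ and $n'(1)=m'(1)$; and $\xi=\exp\int_{q_*}^{q^*}-\frac1{q(1-q)}\frac{m(q)-n(q)}{\ell(q)-n(q)}\,dq$. The optimal purchase and sale boundaries (as fractions of wealth in the risky asset) are $$p_*=\frac{q_*}{\gamma^\uparrow+(1-\gamma^\uparrow)q_*},\qquad p^*=\frac{\gamma^\downarrow q^*}{1+(\gamma^\downarrow-1)q^*}.$$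 *Sufficient condition.* Let $c(q):=\ell(q)+\frac{(S-1)q}{2S-(S+1)q}\,(m(q)-\ell(q))$. We say that the sufficient condition holds for $R$ if (a) $S<1$, or (b) $S>1$, $m(0)>0$ and at least one of the following holds: (i) $2c(q)-qc'(q)>0$ for all $q\in(0,1)$ if $q_M\le1$, respectively for all $q\in(0,\frac{2S}{S+1})$ if $q_M>1$; (ii) $R\ge2$; (iii) $\ell'(0)\ge0$. **Proposition 7.3.** Let $\lambda>0$, and let $\hat R>\tilde R$ be such that the problems for $R=\hat R$ and for $R=\tilde R$ (all other parameters being the same) are well-posed, with boundaries $(\hat p_*,\hat p^*)$ and $(\tilde p_*,\tilde p^*)$. If the sufficient condition holds for $R=\hat R$ and for $R=\tilde R$, then $\hat p_*\le\tilde p_*$ and $\hat p^*\le\tilde p^*$. Consequently, over those $R$ for which the problem is well-posed: 1. If $S<1$, then $p_*$ and $p^*$ are non-increasing in $R\in(0,1)$. 2. If $S>1$ and $m(0)>0$, then $p_*$ and $p^*$ are non-increasing in $R\in[2,\infty)$; if also $\lambda\ge\frac{\sigma}{2}$, they are non-increasing in $R\in(1,\infty)$. -/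

import Mathlib

open Set MeasureTheory

noncomputable section

namespace EpsteinZin

/-- All parameters of the investment-consumption problem under Epstein--Zin utility with
proportional transaction costs, except the relative risk aversion `R`: interest rate `r`, drift
`μ` and volatility `σ` of the risky asset, discount parameter `δ`, elasticity of intertemporal
complementarity `S`, and transaction cost parameters `γup` (buying) and `γdn` (selling). -/
structure Market where
  r : ℝ
  μ : ℝ
  σ : ℝ
  δ : ℝ
  S : ℝ
  γup : ℝ
  γdn : ℝ
  σ_pos : 0 < σ
  S_pos : 0 < S
  S_ne_one : S ≠ 1
  one_le_γup : 1 ≤ γup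
  one_le_γdn : 1 ≤ γdn

namespace Market

/-- The market price of risk. -/
def lam (P : Market) : ℝ := (P.μ - P.r) / P.σ

/-- The round-trip transaction cost. -/
def ξ (P : Market) : ℝ := P.γup * P.γdn

/-- The parameter `θ = (1 - R) / (1 - S)` of the Epstein--Zin aggregator. -/
def θ (P : Market) (R : ℝ) : ℝ := (1 - R) / (1 - P.S)

/-- The admissible coefficients of relative risk aversion: `R ∈ (0, ∞) \ {1}` and `θ > 0`. -/
def AdmissibleR (P : Market) (R : ℝ) : Prop := 0 < R ∧ R ≠ 1 ∧ 0 < P.θ R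

/-- The Merton ratio. -/
def qM (P : Market) (R : ℝ) : ℝ := P.lam / (R * P.σ)

/-- The optimal consumption rate per unit of wealth in the frictionless problem, when the constant
fraction `q` of wealth is invested in the risky asset. -/
def m (P : Market) (R q : ℝ) : ℝ :=
  P.δ / P.S - (1 - P.S) / P.S * (P.r + P.lam * P.σ * q - q ^ 2 * P.σ ^ 2 / 2 * R)

/-- The quadratic `ℓ`, where `α = δ - r (1 - S)` is the effective impatience rate. -/
def ell (P : Market) (R q : ℝ) : ℝ :=
  (P.δ - P.r * (1 - P.S)) / P.S
    - (1 - P.S) / P.S * (P.lam * P.σ - P.σ ^ 2 / 2) * q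
    - (1 - R) * ((1 - P.S) / P.S) * (P.σ ^ 2 / 2) * q ^ 2

/-- The right-hand side `O(n, q)` of the ODE for the optimal consumption rate. -/
def odeRHS (P : Market) (R x q : ℝ) : ℝ :=
  (1 - P.S) / P.S * (x / (1 - q)) * ((P.m R q - x) / (P.ell R q - x))

/-- The integrand in the definition of the threshold transaction cost. -/
def thresholdIntegrand (P : Market) (R q : ℝ) : ℝ :=
  -(1 / (q * (1 - q))) * (P.m R q / P.ell R q)

/-- The zeros of `m`. -/
def zerosM (P : Market) (R : ℝ) : Set ℝ := {q | P.m R q = 0}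

open Classical in
/-- The threshold transaction cost `ξ̄`. It is `1` if the quadratic `m` has at most one zero. If `m`
has two zeros `q₋ < q₊` (which are then the infimum and the supremum of the set of zeros), it is the
exponential of the integral over `[q₋, q₊]`, understood as `∞` if the integrand is not absolutely
integrable there. -/
def thresholdCost (P : Market) (R : ℝ) : EReal :=
  if (P.zerosM R).Nontrivial then
    if IntervalIntegrable (P.thresholdIntegrand R) volume
        (sInf (P.zerosM R)) (sSup (P.zerosM R)) then
      ((Real.exp (∫ q in (sInf (P.zerosM R))..(sSup (P.zerosM R)),
        P.thresholdIntegrand R q) : ℝ) : EReal)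
    else ⊤
  else 1

/-- Well-posedness of the problem: the round-trip cost `ξ ∈ (1, ∞)` lies in the well-posedness range
of transaction costs. -/
def WellPosed (P : Market) (R : ℝ) : Prop :=
  1 < P.ξ ∧
    ((R < 1 ∧ 0 < P.m R 0 ∧ 0 < P.m R 1 ∧ P.thresholdCost R < (P.ξ : EReal)) ∨
     (1 < R ∧ 0 < P.m R (P.qM R) ∧ (P.ξ : EReal) < P.thresholdCost R))

/-- `(a, b, n)` solves the free boundary problem: `a` and `b` are the purchase and sale boundaries
`q_*` and `q^*` of the shadow no-transaction region, and `n`, of which only the values on `[a, b]`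
matter, is the optimal consumption rate per unit of shadow wealth. -/
structure IsFreeBoundarySolution (P : Market) (R a b : ℝ) (n : ℝ → ℝ) : Prop where
  lt : a < b
  loc_mid : P.qM R ∈ Ioo (0 : ℝ) 1 → 0 < a ∧ a < P.qM R ∧ P.qM R < b ∧ b < 1
  loc_one : P.qM R = 1 → 0 < a ∧ b = 1
  loc_gt : 1 < P.qM R → 0 < a ∧ a < P.qM R ∧ P.qM R < b ∧ b < 2 * P.qM R - 1
  loc_neg : P.qM R < 0 → 2 * P.qM R < a ∧ a < P.qM R ∧ P.qM R < b ∧ b < 0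
  contDiffOn : ContDiffOn ℝ 1 n (Icc a b)
  pos : ∀ q ∈ Icc a b, 0 < n q
  ne_ell : ∀ q ∈ Icc a b, q ≠ 1 → n q ≠ P.ell R q
  anti : R < 1 → AntitoneOn n (Icc a b)
  mono : 1 < R → MonotoneOn n (Icc a b)
  ode : ∀ q ∈ Icc a b, q ≠ 1 → derivWithin n (Icc a b) q = P.odeRHS R (n q) q
  left_val : n a = P.m R a
  right_val : n b = P.m R b
  /-- At a boundary point equal to `1` the slope is prescribed by `one_deriv` instead. -/
  left_deriv : a ≠ 1 → derivWithin n (Icc a b) a = 0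
  right_deriv : b ≠ 1 → derivWithin n (Icc a b) b = 0
  one_val : 1 ∈ Icc a b → n 1 = P.m R 1
  one_deriv : 1 ∈ Icc a b → derivWithin n (Icc a b) 1 = deriv (P.m R) 1
  integral_eq : P.ξ = Real.exp (∫ q in a..b,
    -(1 / (q * (1 - q))) * ((P.m R q - n q) / (P.ell R q - n q)))

/-- `pl` and `pu` are the optimal purchase and sale boundaries `p_*` and `p^*` of the no-transaction
region, expressed as fractions of wealth held in the risky asset. -/
def IsBoundaryPair (P : Market) (R pl pu : ℝ) : Prop :=
  ∃ (a b : ℝ) (n : ℝ → ℝ), P.IsFreeBoundarySolution R a b n ∧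
    pl = a / (P.γup + (1 - P.γup) * a) ∧
    pu = P.γdn * b / (1 + (P.γdn - 1) * b)

/-- The function `c`; see `odeRHS_cfun` for the equation that defines it. -/
def cfun (P : Market) (R q : ℝ) : ℝ :=
  P.ell R q + (P.S - 1) * q / (2 * P.S - (P.S + 1) * q) * (P.m R q - P.ell R q)

lemma ell_sub_m (P : Market) (R q : ℝ) :
    P.ell R q - P.m R q = (1 - P.S) / P.S * (P.σ ^ 2 / 2) * (q * (1 - q)) := by
  have := P.S_pos.ne'
  simp only [ell, m]
  field_simp
  ring

/-- `x = c(q)` solves the equation `O(x, q) / x = 2 / q`. -/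
lemma odeRHS_cfun (P : Market) (R q : ℝ) (h0 : q ≠ 0) (h1 : q ≠ 1)
    (h2 : q ≠ 2 * P.S / (P.S + 1)) :
    P.odeRHS R (P.cfun R q) q = 2 / q * P.cfun R q := by
  have hS := P.S_pos
  have hS1 : P.S - 1 ≠ 0 := sub_ne_zero.2 P.S_ne_one
  have hq : 1 - q ≠ 0 := sub_ne_zero.2 h1.symm
  have hD : 2 * P.S - (P.S + 1) * q ≠ 0 := by
    intro h
    apply h2
    rw [eq_div_iff (by positivity)]
    linarith
  have hd : P.m R q - P.ell R q ≠ 0 := by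
    have h := P.ell_sub_m R q
    have hne : (1 - P.S) / P.S * (P.σ ^ 2 / 2) * (q * (1 - q)) ≠ 0 := by
      have h3 : 1 - P.S ≠ 0 := fun h => hS1 (by linarith)
      have := P.σ_pos.ne'
      positivity
    intro h'
    apply hne
    linarith
  have e1 : P.m R q - P.cfun R q
      = 2 * P.S * (1 - q) / (2 * P.S - (P.S + 1) * q) * (P.m R q - P.ell R q) := by
    have h : 2 * P.S * (1 - q) / (2 * P.S - (P.S + 1) * q)
        = 1 - (P.S - 1) * q / (2 * P.S - (P.S + 1) * q) := by
      rw [eq_sub_iff_add_eq, ← add_div, div_eq_one_iff_eq hD]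
      ring
    rw [h, cfun]
    ring
  have e2 : P.ell R q - P.cfun R q
      = -((P.S - 1) * q / (2 * P.S - (P.S + 1) * q) * (P.m R q - P.ell R q)) := by
    simp only [cfun]; ring
  rw [odeRHS, e1, e2]
  generalize 2 * P.S - (P.S + 1) * q = D at hD
  generalize P.m R q - P.ell R q = w at hd
  field_simp
  ring

/-- `2 c(q) - q c'(q) > 0` on `(0, 1)` if `q_M ≤ 1`, and on `(0, 2S/(S+1))` if `q_M > 1`. -/
def CfunCondition (P : Market) (R : ℝ) : Prop :=
  (P.qM R ≤ 1 → ∀ q ∈ Ioo (0 : ℝ) 1, 0 < 2 * P.cfun R q - q * deriv (P.cfun R) q) ∧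
  (1 < P.qM R → ∀ q ∈ Ioo (0 : ℝ) (2 * P.S / (P.S + 1)),
    0 < 2 * P.cfun R q - q * deriv (P.cfun R) q)

/-- One of the sufficient conditions (for `2 n(q) - q n'(q) > 0`) on the parameters holds. -/
def SufficientCondition (P : Market) (R : ℝ) : Prop :=
  P.S < 1 ∨
    (1 < P.S ∧ 0 < P.m R 0 ∧ (P.CfunCondition R ∨ 2 ≤ R ∨ 0 ≤ deriv (P.ell R) 0))

/-- Both boundaries are decreasing (non-increasing) in `R` over those `R ∈ A` for which the
problem is well-posed. -/
def BoundariesDecreaseOn (P : Market) (A : Set ℝ) : Prop :=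
  ∀ R₁ ∈ A, ∀ R₂ ∈ A, R₁ < R₂ → P.AdmissibleR R₁ → P.AdmissibleR R₂ →
    P.WellPosed R₁ → P.WellPosed R₂ →
    ∀ pl₁ pu₁ pl₂ pu₂ : ℝ, P.IsBoundaryPair R₁ pl₁ pu₁ → P.IsBoundaryPair R₂ pl₂ pu₂ →
      pl₂ ≤ pl₁ ∧ pu₂ ≤ pu₁

end Market

end EpsteinZin

end

/-! Write κ = (1 - S)/S, and let Z be the logarithmic derivative of n divided by -κ. Then Z ≥ 0, Z
vanishes at each endpoint other than 1, the ODE becomes the algebraic relation n = m + κ(σ²/2) ·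
`excess q Z`, with `excess` strictly increasing in Z away from q = 1, and the cost constraint
becomes log ξ = ∫ Z/q.

Let Z and Z' belong to R > R'. Where Z = Z', the difference of the excesses has derivative -(R - R')
q (2 + κqZ) (`exists_deriv_neg`), so if 2 + κqZ > 0, then Z - Z' can cross zero only downwards. If a
> a', then Z ≤ Z' to the right of a; this forces b ≤ b' and makes ∫ Z/q strictly smaller than ∫
Z'/q, although both equal log ξ. The case b > b' is excluded likewise, going left from b'
(`boundaries_le`). At q = 1, where `excess` degenerates, the prescribed slope takes over
(`lt_at_one`).

The positivity of 2 + κqZ (`two_add_pos`) is immediate for S < 1. For S > 1, a zero of it is a point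
where n meets c. There 2c - qc' > 0 (`two_mul_cfun_sub_pos`) makes it negative just to the left, so
a nonpositive value would persist back to a, where the quantity is positive.

Finally p_* and p^* increase with q_* and q^* as long as their denominators are positive, which for
q_* > 1 follows from `xi_mul_lt`. -/

noncomputable section

namespace EpsteinZin

open Filter Topology

/-! ### Propagation of signs -/

/-- A continuous function that is nonpositive at the left end of an interval and becomes negative
to the right of each of its zeros is nonpositive. -/
lemma nonpos_of_left_nonpos {f : ℝ → ℝ} {α β : ℝ} (hf : ContinuousOn f (Icc α β))
    (h0 : f α ≤ 0) (h : ∀ x ∈ Ico α β, f x = 0 → ∀ᶠ y in 𝓝[>] x, f y < 0) :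
    ∀ x ∈ Icc α β, f x ≤ 0 := by
  rcases lt_or_ge β α with hlt | hle
  · intro x hx
    exact absurd (hx.1.trans hx.2) (not_le.2 hlt)
  have hcl : IsClosed ({x | f x ≤ 0} ∩ Icc α β) := by
    have := hf.preimage_isClosed_of_isClosed isClosed_Icc (isClosed_Iic (a := (0 : ℝ)))
    rwa [inter_comm] at this
  refine hcl.Icc_subset_of_forall_exists_gt h0 ?_
  rintro x ⟨hx0, hx⟩ y hy
  have hev : ∀ᶠ z in 𝓝[>] x, f z ≤ 0 := by
    rcases (show f x ≤ 0 from hx0).lt_or_eq with hlt | heq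
    · have hc : ContinuousWithinAt f (Icc α β) x := hf x ⟨hx.1, hx.2.le⟩
      have h1 : ∀ᶠ z in 𝓝[Icc α β] x, f z < 0 := hc.eventually (gt_mem_nhds hlt)
      have h2 : 𝓝[>] x ≤ 𝓝[Icc α β] x := by
        rw [← nhdsWithin_Ioo_eq_nhdsGT hx.2]
        exact nhdsWithin_mono _ fun z hz => ⟨hx.1.trans hz.1.le, hz.2.le⟩
      exact (h1.filter_mono h2).mono fun z hz => hz.le
    · exact (h x hx heq).mono fun z hz => hz.le
  have hy' : ∀ᶠ z in 𝓝[>] x, z ∈ Ioc x y := Ioc_mem_nhdsGT hy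
  obtain ⟨z, hz1, hz2⟩ := (hev.and hy').exists
  exact ⟨z, hz1, hz2⟩

/-- A continuous function that is nonpositive at the right end of an interval and is negative
just to the left of each of its zeros is nonpositive. -/
lemma nonpos_of_right_nonpos {f : ℝ → ℝ} {α β : ℝ} (hf : ContinuousOn f (Icc α β))
    (h0 : f β ≤ 0) (h : ∀ x ∈ Ioc α β, f x = 0 → ∀ᶠ y in 𝓝[<] x, f y < 0) :
    ∀ x ∈ Icc α β, f x ≤ 0 := by
  have key := nonpos_of_left_nonpos (f := fun x => f (-x)) (α := -β) (β := -α)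
    (hf.comp continuousOn_neg fun x hx => ⟨by linarith [hx.2], by linarith [hx.1]⟩)
    (by simpa using h0) (by
      intro x hx hfx
      have h1 := h (-x) ⟨by linarith [hx.2], by linarith [hx.1]⟩ hfx
      have ht : Tendsto (fun y : ℝ => -y) (𝓝[>] x) (𝓝[<] (-x)) := tendsto_neg_nhdsGT
      exact ht.eventually h1)
  intro x hx
  simpa using key (-x) ⟨by linarith [hx.2], by linarith [hx.1]⟩

/-- Just to the right of a zero with negative one-sided derivative, a function is negative. -/
lemma eventually_neg_right {f : ℝ → ℝ} {s : Set ℝ} {x d : ℝ} (hf : HasDerivWithinAt f d s x)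
    (hs : s ∈ 𝓝[>] x) (hx : f x = 0) (hd : d < 0) : ∀ᶠ y in 𝓝[>] x, f y < 0 := by
  have h1 : HasDerivWithinAt f d (Ioi x) x := by
    have := hf.mono (inter_subset_left (s := s) (t := Ioi x))
    rwa [hasDerivWithinAt_iff_hasFDerivWithinAt, HasFDerivWithinAt,
      nhdsWithin_inter_of_mem hs] at this
  have h2 := (hasDerivWithinAt_iff_tendsto_slope' (by simp)).1 h1
  filter_upwards [h2.eventually (gt_mem_nhds hd), self_mem_nhdsWithin] with y hy hxy
  have hxy' : 0 < y - x := sub_pos.2 hxy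
  rw [slope_def_field, hx, sub_zero] at hy
  by_contra hc
  exact absurd (div_nonneg (not_lt.1 hc) hxy'.le) (not_le.2 hy)

/-- Just to the left of a zero with negative one-sided derivative, a function is positive. -/
lemma eventually_pos_left {f : ℝ → ℝ} {s : Set ℝ} {x d : ℝ} (hf : HasDerivWithinAt f d s x)
    (hs : s ∈ 𝓝[<] x) (hx : f x = 0) (hd : d < 0) : ∀ᶠ y in 𝓝[<] x, 0 < f y := by
  have h1 : HasDerivWithinAt f d (Iio x) x := by
    have := hf.mono (inter_subset_left (s := s) (t := Iio x))
    rwa [hasDerivWithinAt_iff_hasFDerivWithinAt, HasFDerivWithinAt,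
      nhdsWithin_inter_of_mem hs] at this
  have h2 := (hasDerivWithinAt_iff_tendsto_slope' (by simp)).1 h1
  filter_upwards [h2.eventually (gt_mem_nhds hd), self_mem_nhdsWithin] with y hy hxy
  have hxy' : y - x < 0 := sub_neg.2 hxy
  rw [slope_def_field, hx, sub_zero] at hy
  by_contra hc
  exact absurd (div_nonneg_of_nonpos (not_lt.1 hc) hxy'.le) (not_le.2 hy)

/-! ### The excess function -/

/-- The excess `(n - m) / (κ σ² / 2)` as a function of the logarithmic slope `z = -n' / (κ n)`. -/
def excess (q z : ℝ) : ℝ := z * q * (1 - q) ^ 2 / (1 + z * (1 - q))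

/-- As a function of z, `excess q` is a Möbius map with derivative q(1 - q)²/(1 + z(1 - q))². It is
identically zero at q = 1, which is why that point is excluded. -/
lemma excess_lt_excess_iff {q z w : ℝ} (hq : 0 < q) (hq1 : q ≠ 1) (hz : 0 < 1 + z * (1 - q))
    (hw : 0 < 1 + w * (1 - q)) : excess q z < excess q w ↔ z < w := by
  have h1 : 0 < q * (1 - q) ^ 2 := mul_pos hq (by
    have : 1 - q ≠ 0 := sub_ne_zero.2 hq1.symm
    positivity)
  rw [excess, excess, div_lt_div_iff₀ hz hw]
  have e : w * q * (1 - q) ^ 2 * (1 + z * (1 - q)) - z * q * (1 - q) ^ 2 * (1 + w * (1 - q))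
      = q * (1 - q) ^ 2 * (w - z) := by ring
  constructor
  · intro h
    have : 0 < q * (1 - q) ^ 2 * (w - z) := by linarith
    exact sub_pos.1 (pos_of_mul_pos_right this h1.le)
  · intro h
    have := mul_pos h1 (sub_pos.2 h)
    linarith

/-! ### Reduction of the free boundary problem to the logarithmic slope -/

namespace Market

/-- The coefficient `(1 - S) / S`. -/
def kap (P : Market) : ℝ := (1 - P.S) / P.S

lemma kap_ne_zero (P : Market) : P.kap ≠ 0 :=
  div_ne_zero (sub_ne_zero.2 P.S_ne_one.symm) P.S_pos.ne'

lemma m_eq (P : Market) (R q : ℝ) :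
    P.m R q = P.m 0 0 - P.kap * P.lam * P.σ * q + P.kap * (P.σ ^ 2 / 2) * R * q ^ 2 := by
  simp only [m, kap]
  ring

lemma hasDerivAt_m (P : Market) (R q : ℝ) :
    HasDerivAt (P.m R) (-(P.kap * P.lam * P.σ) + P.kap * P.σ ^ 2 * R * q) q := by
  have h : P.m R = fun q => P.m 0 0 - P.kap * P.lam * P.σ * q
      + P.kap * (P.σ ^ 2 / 2) * R * q ^ 2 := funext fun q => P.m_eq R q
  rw [h]
  have := (((hasDerivAt_id q).const_mul (P.kap * P.lam * P.σ)).const_sub (P.m 0 0)).add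
    (((hasDerivAt_id q).pow 2).const_mul (P.kap * (P.σ ^ 2 / 2) * R))
  refine this.congr_deriv ?_
  simp
  ring

/-- The free boundary problem rewritten in terms of `Z = -n' / (κ n)`, for `κ = (1 - S) / S`. -/
structure ReducedSolution (P : Market) (R a b : ℝ) (n Z : ℝ → ℝ) : Prop where
  lt : a < b
  left_pos : 0 < a
  left_lt : a < P.qM R
  lt_right : P.qM R ≠ 1 → P.qM R < b
  right_lt_one : P.qM R < 1 → b < 1
  right_eq_one : P.qM R = 1 → b = 1
  pos : ∀ q ∈ Icc a b, 0 < n q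
  cont : ContinuousOn Z (Icc a b)
  nonneg : ∀ q ∈ Icc a b, 0 ≤ Z q
  deriv : ∀ q ∈ Icc a b, HasDerivWithinAt n (-P.kap * n q * Z q) (Icc a b) q
  dom : ∀ q ∈ Icc a b, 0 < 1 + Z q * (1 - q)
  eq_add : ∀ q ∈ Icc a b, n q = P.m R q + P.kap * (P.σ ^ 2 / 2) * excess q (Z q)
  one : 1 ∈ Icc a b →
    P.kap * P.m R 1 * Z 1 = P.kap * P.lam * P.σ - P.kap * P.σ ^ 2 * R
  left_zero : a ≠ 1 → Z a = 0
  right_zero : b ≠ 1 → Z b = 0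
  integral : P.ξ = Real.exp (∫ q in a..b, Z q / q)

lemma AdmissibleR.cases {P : Market} {R : ℝ} (h : P.AdmissibleR R) :
    (P.S < 1 ∧ R < 1) ∨ (1 < P.S ∧ 1 < R) := by
  have h2 := h.2.2
  rcases lt_or_gt_of_ne P.S_ne_one with hS | hS
  · left
    refine ⟨hS, ?_⟩
    have := pos_of_mul_pos_left (b := (1 - P.S)⁻¹) h2 (inv_nonneg.2 (by linarith))
    linarith
  · right
    refine ⟨hS, ?_⟩
    by_contra hR
    have : P.θ R ≤ 0 := div_nonpos_of_nonneg_of_nonpos (by linarith) (by linarith)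
    linarith

lemma qM_pos {P : Market} (hlam : 0 < P.lam) {R : ℝ} (hR : 0 < R) : 0 < P.qM R :=
  div_pos hlam (mul_pos hR P.σ_pos)

/-- The ODE expresses Z through m - n and ℓ - n; since ℓ - m = κ(σ²/2) q(1 - q), it can be solved
for n. The monotonicity of n matches the sign of κ, because θ > 0 puts R and S on the same side of
1. -/
lemma IsFreeBoundarySolution.reduced {P : Market} (hlam : 0 < P.lam) {R a b : ℝ} {n : ℝ → ℝ}
    (hR : P.AdmissibleR R) (h : P.IsFreeBoundarySolution R a b n) :
    P.ReducedSolution R a b n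
      (fun q => -(derivWithin n (Icc a b) q) / (P.kap * n q)) := by
  have hq := qM_pos hlam hR.1
  have hk := P.kap_ne_zero
  have hσ := P.σ_pos
  have hdiff : ∀ q ∈ Icc a b, HasDerivWithinAt n (derivWithin n (Icc a b) q) (Icc a b) q :=
    fun q hq => ((h.contDiffOn.differentiableOn one_ne_zero) q hq).hasDerivWithinAt
  have hloc : 0 < a ∧ a < P.qM R ∧ (P.qM R ≠ 1 → P.qM R < b) ∧ (P.qM R < 1 → b < 1) := by
    rcases lt_trichotomy (P.qM R) 1 with h1 | h1 | h1
    · obtain ⟨i, j, k, l⟩ := h.loc_mid ⟨hq, h1⟩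
      exact ⟨i, j, fun _ => k, fun _ => l⟩
    · obtain ⟨i, j⟩ := h.loc_one h1
      have := h.lt
      exact ⟨i, by linarith, fun hb => absurd h1 hb, fun hlt => absurd h1 hlt.ne⟩
    · obtain ⟨i, j, k, l⟩ := h.loc_gt h1
      exact ⟨i, j, fun _ => k, fun hlt => absurd hlt (not_lt.2 h1.le)⟩
  obtain ⟨ha, haM, hMb, hb1⟩ := hloc
  have hone : 1 ∈ Icc a b → P.kap * P.m R 1 * (-(derivWithin n (Icc a b) 1) / (P.kap * n 1))
      = P.kap * P.lam * P.σ - P.kap * P.σ ^ 2 * R := by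
    intro h1
    have hn := h.pos 1 h1
    rw [h.one_deriv h1, (P.hasDerivAt_m R 1).deriv]
    rw [h.one_val h1] at hn ⊢
    field_simp
    ring
  set Z : ℝ → ℝ := fun q => -(derivWithin n (Icc a b) q) / (P.kap * n q) with hZ
  have hderiv : ∀ q ∈ Icc a b, derivWithin n (Icc a b) q = -P.kap * n q * Z q := by
    intro q hq
    have := (h.pos q hq).ne'
    simp only [hZ]
    field_simp
  have hcont : ContinuousOn Z (Icc a b) := by
    refine ContinuousOn.div
      (h.contDiffOn.continuousOn_derivWithin (uniqueDiffOn_Icc h.lt) le_rfl).neg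
      (continuousOn_const.mul h.contDiffOn.continuousOn) fun q hq => ?_
    exact mul_ne_zero hk (h.pos q hq).ne'
  have hnonneg : ∀ q ∈ Icc a b, 0 ≤ Z q := by
    intro q hq
    have hn := h.pos q hq
    rcases hR.cases with ⟨hS, hR1⟩ | ⟨hS, hR1⟩
    · have hd : derivWithin n (Icc a b) q ≤ 0 := (h.anti hR1).derivWithin_nonpos
      have hkp : 0 < P.kap := div_pos (by linarith) P.S_pos
      exact div_nonneg (by linarith) (by positivity)
    · have hd : 0 ≤ derivWithin n (Icc a b) q := (h.mono hR1).derivWithin_nonneg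
      have hkp : P.kap < 0 := div_neg_of_neg_of_pos (by linarith) P.S_pos
      exact div_nonneg_of_nonpos (by linarith) (mul_nonpos_of_nonpos_of_nonneg hkp.le hn.le)
  have hZne : ∀ q ∈ Icc a b, q ≠ 1 →
      Z q = -(1 / (1 - q)) * ((P.m R q - n q) / (P.ell R q - n q)) := by
    intro q hq hq1
    have hn := (h.pos q hq).ne'
    have hl : P.ell R q - n q ≠ 0 := sub_ne_zero.2 (h.ne_ell q hq hq1).symm
    have hq1' : 1 - q ≠ 0 := sub_ne_zero.2 hq1.symm
    simp only [hZ]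
    rw [h.ode q hq hq1, odeRHS]
    change -(P.kap * (n q / (1 - q)) * ((P.m R q - n q) / (P.ell R q - n q)))
      / (P.kap * n q) = _
    field_simp
  have hmul : ∀ q ∈ Icc a b, q ≠ 1 → (n q - P.m R q) * (1 + Z q * (1 - q))
      = P.kap * (P.σ ^ 2 / 2) * (Z q * q * (1 - q) ^ 2) := by
    intro q hq hq1
    have hl : P.ell R q - n q ≠ 0 := sub_ne_zero.2 (h.ne_ell q hq hq1).symm
    have hq1' : 1 - q ≠ 0 := sub_ne_zero.2 hq1.symm
    have e1 : Z q * (1 - q) * (P.ell R q - n q) = n q - P.m R q := by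
      rw [hZne q hq hq1]
      field_simp
      ring
    have e2 := P.ell_sub_m R q
    change _ = P.kap * (P.σ ^ 2 / 2) * (q * (1 - q)) at e2
    linear_combination (-1) * e1 + Z q * (1 - q) * e2
  have hdom_ne : ∀ q ∈ Icc a b, 1 + Z q * (1 - q) ≠ 0 := by
    intro q hq h0
    have hq1 : q ≠ 1 := by
      rintro rfl
      simp at h0
    have hq1' : 1 - q ≠ 0 := sub_ne_zero.2 hq1.symm
    have hq0 : q ≠ 0 := (ha.trans_le hq.1).ne'
    have h1 := hmul q hq hq1
    rw [h0, mul_zero] at h1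
    have hz : Z q = 0 := by
      by_contra hz
      have : P.kap * (P.σ ^ 2 / 2) * (Z q * q * (1 - q) ^ 2) ≠ 0 := by positivity
      exact this h1.symm
    rw [hz] at h0
    norm_num at h0
  have hright : b ≠ 1 → Z b = 0 := by
    intro hb
    simp [hZ, h.right_deriv hb]
  have hdom : ∀ q ∈ Icc a b, 0 < 1 + Z q * (1 - q) := by
    intro q hq
    rcases le_or_gt q 1 with hq1 | hq1
    · have := mul_nonneg (hnonneg q hq) (sub_nonneg.2 hq1)
      linarith
    -- For q > 1 the factor equals 1 at b, since Z b = 0, and never vanishes, so by continuity it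
    -- keeps its sign.
    · by_contra hneg
      have hb : Z b = 0 := hright (by linarith [hq.2])
      have hc : ContinuousOn (fun x => 1 + Z x * (1 - x)) (Icc q b) :=
        (continuousOn_const.add (hcont.mul (by fun_prop))).mono (Icc_subset_Icc_left hq.1)
      obtain ⟨x, hx, hx0⟩ := intermediate_value_Icc hq.2 hc
        (show (0 : ℝ) ∈ Icc _ _ from ⟨not_lt.1 hneg, by simp [hb]⟩)
      exact hdom_ne x ⟨hq.1.trans hx.1, hx.2⟩ hx0
  refine ⟨h.lt, ha, haM, hMb, hb1, fun h1 => (h.loc_one h1).2, h.pos, hcont, hnonneg, ?_, hdom,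
    ?_, hone, ?_, hright, ?_⟩
  · intro q hq
    exact (hdiff q hq).congr_deriv (hderiv q hq)
  · intro q hq
    rcases eq_or_ne q 1 with rfl | hq1
    · rw [h.one_val hq]
      simp [excess]
    · have h1 := hmul q hq hq1
      rw [excess, mul_div_assoc', ← h1, mul_div_cancel_right₀ _ (hdom_ne q hq)]
      ring
  · intro hne
    simp [hZ, h.left_deriv hne]
  · rw [h.integral_eq]
    congr 1
    -- The two integrands may differ at the singular point 1, which is a null set.
    refine intervalIntegral.integral_congr_ae ?_
    have : ∀ᵐ x : ℝ, x ≠ 1 := by simp [ae_iff]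
    filter_upwards [this] with x hx hxm
    rw [uIoc_of_le h.lt.le] at hxm
    have hx' : x ∈ Icc a b := Ioc_subset_Icc_self hxm
    have hx0 : x ≠ 0 := (ha.trans_le hx'.1).ne'
    have hq1' : 1 - x ≠ 0 := sub_ne_zero.2 hx.symm
    have hl : P.ell R x - n x ≠ 0 := sub_ne_zero.2 (h.ne_ell x hx' hx).symm
    rw [hZne x hx' hx]
    field_simp

/-! ### The function `c` -/

lemma ell_eq (P : Market) (R q : ℝ) :
    P.ell R q = P.m R q + P.kap * (P.σ ^ 2 / 2) * (q * (1 - q)) := by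
  have := P.ell_sub_m R q
  simp only [kap]
  linarith

/-- The last fraction is `excess q z` at z = -2/(κq), the root of 2 + κqz = 0. This is how c enters
the analysis of 2 + κqZ. -/
lemma cfun_eq (P : Market) (R : ℝ) {q : ℝ} (hD : 2 * P.S - (P.S + 1) * q ≠ 0) :
    P.cfun R q = P.m R q
      + P.kap * (P.σ ^ 2 / 2) * (2 * P.S * q * (1 - q) ^ 2 / (2 * P.S - (P.S + 1) * q)) := by
  rw [cfun, ell_eq]
  obtain ⟨D, hDe⟩ : ∃ D, D = 2 * P.S - (P.S + 1) * q := ⟨_, rfl⟩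
  rw [← hDe] at hD ⊢
  field_simp
  rw [hDe]
  ring

/-- The derivative of `c` and a closed form of `2 c - q c'`. -/
lemma hasDerivAt_cfun (P : Market) (R : ℝ) {q : ℝ} (hD : 2 * P.S - (P.S + 1) * q ≠ 0) :
    ∃ d, HasDerivAt (P.cfun R) d q ∧ 2 * P.cfun R q - q * d =
      2 * P.m 0 0 - P.kap * P.lam * P.σ * q
        + P.kap * (P.σ ^ 2 / 2) * q
          * (4 * P.S * ((1 - q) * (P.S - q)) / (2 * P.S - (P.S + 1) * q) ^ 2) := by
  have hev : P.cfun R =ᶠ[𝓝 q] fun q => P.m R q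
      + P.kap * (P.σ ^ 2 / 2)
        * (2 * P.S * q * (1 - q) ^ 2 / (2 * P.S - (P.S + 1) * q)) := by
    have hc : ContinuousAt (fun q => 2 * P.S - (P.S + 1) * q) q := by fun_prop
    filter_upwards [hc.eventually_ne hD] with x hx using P.cfun_eq R hx
  have hnum : HasDerivAt (fun q => 2 * P.S * q * (1 - q) ^ 2)
      (2 * P.S * ((1 - q) ^ 2 - 2 * q * (1 - q))) q := by
    have := ((hasDerivAt_id q).const_mul (2 * P.S)).mul (((hasDerivAt_id q).const_sub 1).pow 2)
    refine this.congr_deriv ?_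
    simp
    ring
  have hden : HasDerivAt (fun q => 2 * P.S - (P.S + 1) * q) (-(P.S + 1)) q := by
    have := ((hasDerivAt_id q).const_mul (P.S + 1)).const_sub (2 * P.S)
    refine this.congr_deriv ?_
    simp
  refine ⟨_, (((P.hasDerivAt_m R q).add
    ((hnum.div hden hD).const_mul (P.kap * (P.σ ^ 2 / 2)))).congr_of_eventuallyEq hev), ?_⟩
  rw [P.cfun_eq R hD, P.m_eq R q]
  obtain ⟨D, hDe⟩ : ∃ D, D = 2 * P.S - (P.S + 1) * q := ⟨_, rfl⟩
  simp only [← hDe] at hD ⊢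
  field_simp
  rw [hDe]
  ring

lemma deriv_ell_zero (P : Market) (R : ℝ) :
    deriv (P.ell R) 0 = -(P.kap * (P.lam * P.σ - P.σ ^ 2 / 2)) := by
  have h : P.ell R = fun q => P.m R q + P.kap * (P.σ ^ 2 / 2) * (q * (1 - q)) :=
    funext fun q => P.ell_eq R q
  have h2 := (P.hasDerivAt_m R 0).add
    (((hasDerivAt_id (0 : ℝ)).mul ((hasDerivAt_id (0 : ℝ)).const_sub 1)).const_mul
      (P.kap * (P.σ ^ 2 / 2)))
  rw [h]
  refine (h2.congr_deriv ?_).deriv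
  simp
  ring

lemma kap_neg {P : Market} (hS : 1 < P.S) : P.kap < 0 :=
  div_neg_of_neg_of_pos (by linarith) P.S_pos

lemma kap_pos {P : Market} (hS : P.S < 1) : 0 < P.kap :=
  div_pos (by linarith) P.S_pos

lemma m_zero (P : Market) (R : ℝ) : P.m R 0 = P.m 0 0 := by
  rw [P.m_eq R 0]
  simp

/-- Each of the sufficient conditions gives `2 c - q c' > 0` wherever `c` is positive. -/
lemma two_mul_cfun_sub_pos {P : Market} (hlam : 0 < P.lam) (hS : 1 < P.S) {R : ℝ}
    (h0 : 0 < P.m R 0) (h : P.CfunCondition R ∨ 2 ≤ R ∨ 0 ≤ deriv (P.ell R) 0) {q : ℝ}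
    (hq : 0 < q) (hD : 0 < 2 * P.S - (P.S + 1) * q) (hc : 0 < P.cfun R q) :
    ∃ d, HasDerivAt (P.cfun R) d q ∧ 0 < 2 * P.cfun R q - q * d := by
  obtain ⟨d, hd, he⟩ := P.hasDerivAt_cfun R hD.ne'
  refine ⟨d, hd, ?_⟩
  have hk := kap_neg hS
  have hσ := P.σ_pos
  rw [P.m_zero] at h0
  have hkk : P.kap * (P.σ ^ 2 / 2) < 0 := mul_neg_of_neg_of_pos hk (by positivity)
  have hB : P.kap * P.lam * P.σ < 0 :=
    mul_neg_of_neg_of_pos (mul_neg_of_neg_of_pos hk hlam) hσ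
  have hBq : P.kap * P.lam * P.σ * q < 0 := mul_neg_of_neg_of_pos hB hq
  have hkq : P.kap * (P.σ ^ 2 / 2) * q < 0 := mul_neg_of_neg_of_pos hkk hq
  set T := 4 * P.S * ((1 - q) * (P.S - q)) / (2 * P.S - (P.S + 1) * q) ^ 2 with hT
  -- (2S - (S+1)q)² - 4S(1 - q)(S - q) = ((S - 1)q)².
  have hT1 : T ≤ 1 := by
    rw [hT, div_le_one (by positivity)]
    nlinarith [sq_nonneg ((P.S - 1) * q)]
  rcases le_or_gt 1 q with hq1 | hq1
  · rw [he]
    have hqS : q < P.S := by nlinarith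
    have : T ≤ 0 := div_nonpos_of_nonpos_of_nonneg
      (mul_nonpos_of_nonneg_of_nonpos (by linarith)
        (mul_nonpos_of_nonpos_of_nonneg (by linarith) (by linarith))) (by positivity)
    have := mul_nonneg_of_nonpos_of_nonpos hkq.le this
    linarith
  · rcases h with h | h | h
    · rw [← hd.deriv]
      rcases le_or_gt (P.qM R) 1 with hM | hM
      · exact h.1 hM q ⟨hq, hq1⟩
      · refine h.2 hM q ⟨hq, ?_⟩
        rw [lt_div_iff₀ (by linarith)]
        linarith
    -- With c = m(0) - κλσq + κ(σ²/2) q (Rq + v) and T ≤ 1 < 2q + v ≤ Rq + v, the closed form gives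
    -- 2c - qc' ≥ m(0) + c, which is positive.
    · by_contra hneg
      rw [he] at hneg
      rw [P.cfun_eq R hD.ne', P.m_eq R q] at hc
      have hv : 1 < 2 * q + 2 * P.S * (1 - q) ^ 2 / (2 * P.S - (P.S + 1) * q) := by
        rw [← sub_lt_iff_lt_add', lt_div_iff₀ hD]
        nlinarith [mul_pos hq (show 0 < P.S + 1 - 2 * q by linarith)]
      have e : 2 * P.S * q * (1 - q) ^ 2 / (2 * P.S - (P.S + 1) * q)
          = q * (2 * P.S * (1 - q) ^ 2 / (2 * P.S - (P.S + 1) * q)) := by ring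
      rw [e] at hc
      set v := 2 * P.S * (1 - q) ^ 2 / (2 * P.S - (P.S + 1) * q)
      have h1 : P.kap * (P.σ ^ 2 / 2) * q * (R * q + v) ≤ P.kap * (P.σ ^ 2 / 2) * q * 1 :=
        mul_le_mul_of_nonpos_left (by nlinarith) hkq.le
      have h2 : P.kap * (P.σ ^ 2 / 2) * q * 1 ≤ P.kap * (P.σ ^ 2 / 2) * q * T :=
        mul_le_mul_of_nonpos_left hT1 hkq.le
      nlinarith
    -- Since T ≤ 1 and κ < 0, the terms other than 2m(0) sum to at least q ℓ'(0).
    · rw [he]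
      rw [P.deriv_ell_zero] at h
      have h1 : P.kap * (P.σ ^ 2 / 2) * q * 1 ≤ P.kap * (P.σ ^ 2 / 2) * q * T :=
        mul_le_mul_of_nonpos_left hT1 hkq.le
      have h2 := mul_nonneg h hq.le
      nlinarith

/-! ### Sign properties of a single solution -/

namespace ReducedSolution

variable {P : Market} {R a b : ℝ} {n Z : ℝ → ℝ}

/-- `q² / n` is strictly increasing. -/
lemma two_add_pos (h : P.ReducedSolution R a b n Z) (hlam : 0 < P.lam)
    (hsc : P.SufficientCondition R) : ∀ q ∈ Icc a b, 0 < 2 + P.kap * q * Z q := by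
  have hσ := P.σ_pos
  rcases hsc with hS | ⟨hS, h0, hdisj⟩
  · intro q hq
    have h1 := kap_pos hS
    have h2 := h.nonneg q hq
    have h3 := h.left_pos.trans_le hq.1
    positivity
  have hk := kap_neg hS
  have hkk : P.kap * (P.σ ^ 2 / 2) < 0 := mul_neg_of_neg_of_pos hk (by positivity)
  have hB : P.kap * P.lam * P.σ < 0 :=
    mul_neg_of_neg_of_pos (mul_neg_of_neg_of_pos hk hlam) hσ
  -- The slope condition at 1 gives m(1)(2 + κZ(1)) = 2m(0) - κλσ > 0.
  have hone : 1 ∈ Icc a b → 0 < 2 + P.kap * 1 * Z 1 := by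
    intro h1
    have hn := h.pos 1 h1
    have he : n 1 = P.m R 1 := by simpa [excess] using h.eq_add 1 h1
    have h2 := h.one h1
    rw [he] at hn
    have hm := P.m_eq R 1
    rw [P.m_zero] at h0
    have : 0 < P.m R 1 * (2 + P.kap * 1 * Z 1) := by nlinarith
    exact pos_of_mul_pos_right this hn.le
  have hleft : 0 < 2 + P.kap * a * Z a := by
    rcases eq_or_ne a 1 with ha | ha
    · have := hone ⟨ha.le, ha ▸ h.lt.le⟩
      rwa [← ha] at this
    · rw [h.left_zero ha]
      norm_num
  intro x hx
  by_contra hneg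
  have hf : ContinuousOn (fun q => 2 + P.kap * q * Z q) (Icc a x) :=
    (continuousOn_const.add ((continuousOn_const.mul continuousOn_id).mul h.cont)).mono
      (Icc_subset_Icc_right hx.2)
  have key := nonpos_of_right_nonpos hf (not_lt.1 hneg) ?_ a ⟨le_rfl, hx.1⟩
  · exact absurd hleft (not_lt.2 key)
  intro y hy hy0
  have hyI : y ∈ Icc a b := ⟨hy.1.le, hy.2.trans hx.2⟩
  have hypos : 0 < y := h.left_pos.trans hy.1
  have hy1 : y ≠ 1 := by
    rintro rfl
    exact (hone hyI).ne' hy0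
  have hdom := h.dom y hyI
  have hSp := P.S_pos
  have hSk : P.S * P.kap = 1 - P.S := by
    rw [kap, mul_div_cancel₀ _ hSp.ne']
  have hDeq : 2 * P.S - (P.S + 1) * y = -(P.S * P.kap * y) * (1 + Z y * (1 - y)) := by
    linear_combination (P.S * (1 - y)) * hy0 + y * hSk
  have hSky : 0 < -(P.S * P.kap * y) := by
    rw [hSk]
    nlinarith
  have hD : 0 < 2 * P.S - (P.S + 1) * y := by
    rw [hDeq]
    exact mul_pos hSky hdom
  -- At a zero, Z(y) = -2/(κy), so the excess of n is that of c.
  have hnc : n y = P.cfun R y := by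
    rw [h.eq_add y hyI, P.cfun_eq R hD.ne', excess]
    congr 2
    rw [div_eq_div_iff hdom.ne' hD.ne', hDeq]
    linear_combination (-P.S * y * (1 - y) ^ 2 * (1 + Z y * (1 - y))) * hy0
  obtain ⟨d, hd, hpos⟩ := two_mul_cfun_sub_pos hlam hS h0 hdisj hypos hD (hnc ▸ h.pos y hyI)
  have hder := hd.hasDerivWithinAt.sub (h.deriv y hyI)
  have hmem : Icc a b ∈ 𝓝[<] y := by
    rw [← nhdsWithin_Ioo_eq_nhdsLT hy.1]
    exact mem_of_superset self_mem_nhdsWithin fun z hz => ⟨hz.1.le, hz.2.le.trans hyI.2⟩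
  -- At y the logarithmic derivative of n is 2/y, so y times the derivative of c - n is -(2c - yc')
  -- < 0: n lies below c just to the left.
  have hev := eventually_pos_left hder hmem (by simp [hnc]) (by
    have e : y * (d - -P.kap * n y * Z y) = -(2 * P.cfun R y - y * d) := by
      rw [hnc]
      linear_combination P.cfun R y * hy0
    by_contra hcon
    have := mul_nonneg hypos.le (not_lt.1 hcon)
    linarith)
  have hDev : ∀ᶠ z in 𝓝[<] y, 0 < 2 * P.S - (P.S + 1) * z := by
    have hc : ContinuousAt (fun q => 2 * P.S - (P.S + 1) * q) y := by fun_prop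
    exact (hc.eventually (lt_mem_nhds hD)).filter_mono nhdsWithin_le_nhds
  have h1ev : ∀ᶠ z in 𝓝[<] y, z ≠ 1 :=
    (eventually_ne_nhds hy1).filter_mono nhdsWithin_le_nhds
  filter_upwards [hev, hDev, h1ev, hmem] with z hz hzD hz1 hzI
  have hzpos : 0 < z := h.left_pos.trans_le hzI.1
  have hkz : P.kap * z < 0 := mul_neg_of_neg_of_pos hk hzpos
  have hz' : n z < P.cfun R z := sub_pos.1 hz
  have hSkz : P.S * (P.kap * z) < 0 := mul_neg_of_pos_of_neg hSp hkz
  have hw : 1 + (-2 / (P.kap * z)) * (1 - z)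
      = (2 * P.S - (P.S + 1) * z) / (-(P.S * (P.kap * z))) := by
    rw [eq_div_iff (by linarith)]
    have := hk.ne
    field_simp
    linear_combination (-z) * hSk
  have hwpos : 0 < 1 + (-2 / (P.kap * z)) * (1 - z) := by
    rw [hw]
    exact div_pos hzD (by linarith)
  have hex : excess z (-2 / (P.kap * z))
      = 2 * P.S * z * (1 - z) ^ 2 / (2 * P.S - (P.S + 1) * z) := by
    rw [excess, hw]
    have := hk.ne
    field_simp
  rw [P.cfun_eq R hzD.ne', ← hex, h.eq_add z hzI] at hz'
  -- Since κ < 0, n < c means a larger excess, hence Z(z) > -2/(κz), that is 2 + κzZ(z) < 0.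
  have hlt : excess z (-2 / (P.kap * z)) < excess z (Z z) :=
    lt_of_mul_lt_mul_of_nonpos_left (by linarith) hkk.le
  have := (excess_lt_excess_iff hzpos hz1 hwpos (h.dom z hzI)).1 hlt
  rw [div_lt_iff_of_neg hkz] at this
  linarith

/-- In the interior, the logarithmic slope vanishes at most at the Merton ratio. -/
lemma pos_of_mem_Ioo (h : P.ReducedSolution R a b n Z) (hR : 0 < R) {x : ℝ} (hx : x ∈ Ioo a b)
    (hM : x ≠ P.qM R) : 0 < Z x := by
  have hxI := Ioo_subset_Icc_self hx
  refine (h.nonneg x hxI).lt_of_ne fun h0 => hM ?_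
  have hσ := P.σ_pos
  have hk := P.kap_ne_zero
  have hd0 : P.kap * P.lam * P.σ - P.kap * P.σ ^ 2 * R * x = 0 := by
    rcases eq_or_ne x 1 with rfl | hx1
    · have := h.one hxI
      rw [← h0] at this
      linarith
    · have hmem : Icc a b ∈ 𝓝 x := Icc_mem_nhds hx.1 hx.2
      have hder := (((h.deriv x hxI).hasDerivAt hmem).sub (P.hasDerivAt_m R x)).div_const
        (P.kap * (P.σ ^ 2 / 2))
      have hkk : P.kap * (P.σ ^ 2 / 2) ≠ 0 := by positivity
      have hval : ∀ q ∈ Icc a b, (n q - P.m R q) / (P.kap * (P.σ ^ 2 / 2))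
          = excess q (Z q) := by
        intro q hq
        rw [h.eq_add q hq]
        field_simp
        ring
      -- A zero of Z is a minimum of the nonnegative excess, so n and m have equal derivatives
      -- there. That of n is zero with Z, so x is the vertex q_M of m.
      have hmin : IsLocalMin (fun q => (n - P.m R) q / (P.kap * (P.σ ^ 2 / 2))) x := by
        filter_upwards [hmem] with q hq
        rw [Pi.sub_apply, Pi.sub_apply, hval x hxI, hval q hq, ← h0]
        have h1 := h.nonneg q hq
        have h2 := h.dom q hq
        have h3 := h.left_pos.trans_le hq.1
        simp only [excess]
        rw [zero_mul, zero_mul, zero_div]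
        positivity
      have := hmin.hasDerivAt_eq_zero hder
      rw [← h0, div_eq_zero_iff] at this
      rcases this with this | this
      · linarith
      · exact absurd this hkk
  have h2 : P.kap * P.σ * (P.lam - P.σ * R * x) = 0 := by linarith
  have h3 : P.lam - P.σ * R * x = 0 := by
    rcases mul_eq_zero.1 h2 with h4 | h4
    · exact absurd h4 (mul_ne_zero hk hσ.ne')
    · exact h4
  rw [qM, eq_div_iff (by positivity)]
  linarith

end ReducedSolution

/-! ### Comparison of the solutions for two risk aversions -/

namespace ReducedSolution

variable {P : Market} {R a b R' a' b' : ℝ} {n Z n' Z' : ℝ → ℝ}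

/-- The comparison of the logarithmic slopes at the singular point `1` of the equation. -/
lemma lt_at_one (h : P.ReducedSolution R a b n Z) (h' : P.ReducedSolution R' a' b' n' Z')
    (hRR : R' < R) (hpos : ∀ q ∈ Icc a b, 0 < 2 + P.kap * q * Z q) (h1 : 1 ∈ Icc a b)
    (h1' : 1 ∈ Icc a' b') : Z 1 < Z' 1 := by
  have hσ := P.σ_pos
  have e1 := h.one h1
  have e2 := h'.one h1'
  have hn' := h'.pos 1 h1'
  rw [show n' 1 = P.m R' 1 by simpa [excess] using h'.eq_add 1 h1'] at hn'
  rw [P.m_eq R] at e1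
  rw [P.m_eq R'] at e2 hn'
  have hpr : 0 < P.σ ^ 2 / 2 * (R - R') * (2 + P.kap * 1 * Z 1) :=
    mul_pos (mul_pos (by positivity) (sub_pos.2 hRR)) (hpos 1 h1)
  have key : (P.m 0 0 - P.kap * P.lam * P.σ * 1 + P.kap * (P.σ ^ 2 / 2) * R' * 1 ^ 2)
      * (Z' 1 - Z 1) = P.σ ^ 2 / 2 * (R - R') * (2 + P.kap * 1 * Z 1) := by
    apply mul_left_cancel₀ P.kap_ne_zero
    linear_combination e2 - e1
  exact sub_pos.1 (pos_of_mul_pos_right (key ▸ hpr) hn'.le)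

/-- Where the logarithmic slopes of the solutions for `R' < R` agree, the difference of the excesses
has negative derivative. -/
lemma exists_deriv_neg (h : P.ReducedSolution R a b n Z) (h' : P.ReducedSolution R' a' b' n' Z')
    (hRR : R' < R) (hpos : ∀ q ∈ Icc a b, 0 < 2 + P.kap * q * Z q) {I : Set ℝ}
    (hI : I ⊆ Icc a b) (hI' : I ⊆ Icc a' b') {x : ℝ} (hx : x ∈ I) (hZ : Z x = Z' x) :
    x ≠ 1 ∧ ∃ d < 0,
      HasDerivWithinAt (fun q => excess q (Z q) - excess q (Z' q)) d I x := by
  have hσ := P.σ_pos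
  have hk := P.kap_ne_zero
  have hp := hpos x (hI hx)
  have hx0 : 0 < x := h.left_pos.trans_le (hI hx).1
  have hd : 0 < R - R' := sub_pos.2 hRR
  constructor
  · rintro rfl
    exact (h.lt_at_one h' hRR hpos (hI hx) (hI' hx)).ne hZ
  · have hkk : P.kap * (P.σ ^ 2 / 2) ≠ 0 := by positivity
    have hd1 := ((h.deriv x (hI hx)).mono hI).sub (P.hasDerivAt_m R x).hasDerivWithinAt
    have hd2 := ((h'.deriv x (hI' hx)).mono hI').sub (P.hasDerivAt_m R' x).hasDerivWithinAt
    have hval : ∀ q ∈ I, excess q (Z q) - excess q (Z' q)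
        = (((n - P.m R) - (n' - P.m R')) q) / (P.kap * (P.σ ^ 2 / 2)) := by
      intro q hq
      simp only [Pi.sub_apply]
      rw [h.eq_add q (hI hq), h'.eq_add q (hI' hq)]
      field_simp
      ring
    -- Equal slopes give equal excesses, so the values of n differ by exactly as much as those of m,
    -- namely κ(σ²/2)(R - R')x², and their derivatives by -κZ times this.
    refine ⟨-((R - R') * (x * (2 + P.kap * x * Z x))), by
      have := mul_pos hd (mul_pos hx0 hp)
      linarith, ?_⟩
    refine (((hd1.sub hd2).div_const (P.kap * (P.σ ^ 2 / 2))).congr hval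
      (hval x hx)).congr_deriv ?_
    rw [h.eq_add x (hI hx), h'.eq_add x (hI' hx), ← hZ, P.m_eq R x, P.m_eq R' x]
    field_simp
    ring

lemma excess_sub_neg_iff (h : P.ReducedSolution R a b n Z)
    (h' : P.ReducedSolution R' a' b' n' Z') {q : ℝ} (hq : q ∈ Icc a b) (hq' : q ∈ Icc a' b')
    (hq1 : q ≠ 1) : excess q (Z q) - excess q (Z' q) < 0 ↔ Z q - Z' q < 0 := by
  rw [sub_neg, sub_neg]
  exact excess_lt_excess_iff (h.left_pos.trans_le hq.1) hq1 (h.dom q hq) (h'.dom q hq')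

/-- For `R' < R`, the difference of the logarithmic slopes stays nonpositive to the right. -/
lemma le_of_left_le (h : P.ReducedSolution R a b n Z) (h' : P.ReducedSolution R' a' b' n' Z')
    (hRR : R' < R) (hpos : ∀ q ∈ Icc a b, 0 < 2 + P.kap * q * Z q) {α β : ℝ}
    (hI : Icc α β ⊆ Icc a b) (hI' : Icc α β ⊆ Icc a' b') (h0 : Z α ≤ Z' α) :
    ∀ x ∈ Icc α β, Z x ≤ Z' x := by
  intro x hx
  refine sub_nonpos.1 (nonpos_of_left_nonpos (f := fun q => Z q - Z' q) (α := α) (β := β)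
    ((h.cont.mono hI).sub (h'.cont.mono hI')) (sub_nonpos.2 h0) ?_ x hx)
  intro y hy hy0
  have hyI : y ∈ Icc α β := Ico_subset_Icc_self hy
  have hZ : Z y = Z' y := sub_eq_zero.1 hy0
  obtain ⟨hy1, d, hd, hder⟩ := h.exists_deriv_neg h' hRR hpos hI hI' hyI hZ
  have hmem : Icc α β ∈ 𝓝[>] y := by
    rw [← nhdsWithin_Ioo_eq_nhdsGT hy.2]
    exact mem_of_superset self_mem_nhdsWithin fun z hz => ⟨hy.1.trans hz.1.le, hz.2.le⟩
  have hev := eventually_neg_right hder hmem (by rw [hZ, sub_self]) hd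
  have h1ev : ∀ᶠ z in 𝓝[>] y, z ≠ 1 :=
    (eventually_ne_nhds hy1).filter_mono nhdsWithin_le_nhds
  filter_upwards [hev, h1ev, hmem] with z hz hz1 hzI
  exact (h.excess_sub_neg_iff h' (hI hzI) (hI' hzI) hz1).1 hz

/-- For `R' < R`, the difference of the logarithmic slopes stays nonnegative to the left. -/
lemma le_of_right_le (h : P.ReducedSolution R a b n Z) (h' : P.ReducedSolution R' a' b' n' Z')
    (hRR : R' < R) (hpos : ∀ q ∈ Icc a b, 0 < 2 + P.kap * q * Z q) {α β : ℝ}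
    (hI : Icc α β ⊆ Icc a b) (hI' : Icc α β ⊆ Icc a' b') (h0 : Z' β ≤ Z β) :
    ∀ x ∈ Icc α β, Z' x ≤ Z x := by
  intro x hx
  refine sub_nonpos.1 (nonpos_of_right_nonpos (f := fun q => Z' q - Z q) (α := α) (β := β)
    ((h'.cont.mono hI').sub (h.cont.mono hI)) (sub_nonpos.2 h0) ?_ x hx)
  intro y hy hy0
  have hyI : y ∈ Icc α β := Ioc_subset_Icc_self hy
  have hZ : Z y = Z' y := (sub_eq_zero.1 hy0).symm
  obtain ⟨hy1, d, hd, hder⟩ := h.exists_deriv_neg h' hRR hpos hI hI' hyI hZ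
  have hmem : Icc α β ∈ 𝓝[<] y := by
    rw [← nhdsWithin_Ioo_eq_nhdsLT hy.1]
    exact mem_of_superset self_mem_nhdsWithin fun z hz => ⟨hz.1.le, hz.2.le.trans hy.2⟩
  have hev := eventually_pos_left hder hmem (by rw [hZ, sub_self]) hd
  have h1ev : ∀ᶠ z in 𝓝[<] y, z ≠ 1 :=
    (eventually_ne_nhds hy1).filter_mono nhdsWithin_le_nhds
  filter_upwards [hev, h1ev, hmem] with z hz hz1 hzI
  refine (h'.excess_sub_neg_iff h (hI' hzI) (hI hzI) hz1).1 ?_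
  linarith

lemma continuousOn_div (h : P.ReducedSolution R a b n Z) :
    ContinuousOn (fun q => Z q / q) (Icc a b) :=
  h.cont.div continuousOn_id fun _ hq => (h.left_pos.trans_le hq.1).ne'

lemma intervalIntegrable (h : P.ReducedSolution R a b n Z) {c d : ℝ} (hc : c ∈ Icc a b)
    (hd : d ∈ Icc a b) : IntervalIntegrable (fun q => Z q / q) volume c d :=
  (h.continuousOn_div.mono (uIcc_subset_Icc hc hd)).intervalIntegrable

lemma integral_nonneg (h : P.ReducedSolution R a b n Z) {c d : ℝ} (hc : a ≤ c) (hcd : c ≤ d)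
    (hd : d ≤ b) : 0 ≤ ∫ q in c..d, Z q / q :=
  intervalIntegral.integral_nonneg hcd fun q hq =>
    div_nonneg (h.nonneg q ⟨hc.trans hq.1, hq.2.trans hd⟩)
      (h.left_pos.le.trans (hc.trans hq.1))

lemma integral_pos (h : P.ReducedSolution R a b n Z) (hR : 0 < R) {c d : ℝ} (hc : a ≤ c)
    (hcd : c < d) (hd : d ≤ b) (hM : P.qM R ∉ Ioo c d) : 0 < ∫ q in c..d, Z q / q := by
  refine intervalIntegral.intervalIntegral_pos_of_pos_on
    (h.intervalIntegrable ⟨hc, hcd.le.trans hd⟩ ⟨hc.trans hcd.le, hd⟩) ?_ hcd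
  intro x hx
  have hx' : x ∈ Ioo a b := ⟨hc.trans_lt hx.1, hx.2.trans_le hd⟩
  exact div_pos (h.pos_of_mem_Ioo hR hx' fun he => hM (he ▸ hx)) (h.left_pos.trans hx'.1)

lemma integral_le (h : P.ReducedSolution R a b n Z) (h' : P.ReducedSolution R' a' b' n' Z')
    {c d : ℝ} (hcd : c ≤ d) (hI : Icc c d ⊆ Icc a b) (hI' : Icc c d ⊆ Icc a' b')
    (hle : ∀ x ∈ Icc c d, Z x ≤ Z' x) : ∫ q in c..d, Z q / q ≤ ∫ q in c..d, Z' q / q := by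
  have hc : c ∈ Icc c d := ⟨le_rfl, hcd⟩
  have hd : d ∈ Icc c d := ⟨hcd, le_rfl⟩
  refine intervalIntegral.integral_mono_on hcd (h.intervalIntegrable (hI hc) (hI hd))
    (h'.intervalIntegrable (hI' hc) (hI' hd)) fun x hx => ?_
  exact div_le_div_of_nonneg_right (hle x hx) (h.left_pos.le.trans (hI hx).1)

lemma integral_split (h : P.ReducedSolution R a b n Z) {c d : ℝ} (hc : c ∈ Icc a b)
    (hd : d ∈ Icc a b) : ∫ q in a..b, Z q / q
      = (∫ q in a..c, Z q / q) + (∫ q in c..d, Z q / q) + ∫ q in d..b, Z q / q := by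
  have ha : a ∈ Icc a b := ⟨le_rfl, h.lt.le⟩
  have hb : b ∈ Icc a b := ⟨h.lt.le, le_rfl⟩
  rw [intervalIntegral.integral_add_adjacent_intervals (h.intervalIntegrable ha hc)
    (h.intervalIntegrable hc hd), intervalIntegral.integral_add_adjacent_intervals
    (h.intervalIntegrable ha hd) (h.intervalIntegrable hd hb)]

lemma qM_le (h : P.ReducedSolution R a b n Z) : P.qM R ≤ b := by
  by_cases hM : P.qM R = 1
  · rw [hM, h.right_eq_one hM]
  · exact (h.lt_right hM).le

/-- Both shadow boundaries are monotone in the relative risk aversion. -/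
lemma boundaries_le (h : P.ReducedSolution R a b n Z) (h' : P.ReducedSolution R' a' b' n' Z')
    (hlam : 0 < P.lam) (hR' : 0 < R') (hRR : R' < R)
    (hpos : ∀ q ∈ Icc a b, 0 < 2 + P.kap * q * Z q) : a ≤ a' ∧ b ≤ b' := by
  have hR : 0 < R := hR'.trans hRR
  have hM : P.qM R < P.qM R' :=
    div_lt_div_of_pos_left hlam (mul_pos hR' P.σ_pos) (mul_lt_mul_of_pos_right hRR P.σ_pos)
  have heq : ∫ q in a..b, Z q / q = ∫ q in a'..b', Z' q / q :=
    Real.exp_injective (h.integral.symm.trans h'.integral)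
  have haM := h.left_lt
  have haM' := h'.left_lt
  have hbM := h.qM_le
  have hbM' := h'.qM_le
  -- b' = 1 forces the Merton ratio for R' to be 1, so that for R is below 1 and b < 1.
  have hb1 : b' < b → b' ≠ 1 := by
    intro hlt he
    have hM1 : P.qM R' = 1 := by
      by_contra hne
      rcases lt_or_gt_of_ne hne with h1 | h1
      · exact (h'.right_lt_one h1).ne he
      · linarith
    have := h.right_lt_one (hM1 ▸ hM)
    linarith
  have ha : a ≤ a' := by
    by_contra hlt
    rw [not_le] at hlt
    have hle : ∀ β, a ≤ β → β ≤ b → β ≤ b' → ∀ x ∈ Icc a β, Z x ≤ Z' x := by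
      intro β hβ hβb hβb'
      have hI' : Icc a β ⊆ Icc a' b' := Icc_subset_Icc hlt.le hβb'
      refine h.le_of_left_le h' hRR hpos (Icc_subset_Icc_right hβb) hI' ?_
      by_cases ha1 : a = 1
      · have h1 : (1 : ℝ) ∈ Icc a β := ⟨ha1.le, ha1 ▸ hβ⟩
        rw [ha1]
        exact (h.lt_at_one h' hRR hpos (Icc_subset_Icc_right hβb h1) (hI' h1)).le
      · rw [h.left_zero ha1]
        exact h'.nonneg a (hI' ⟨le_rfl, hβ⟩)
    -- Otherwise Z(b') ≤ Z'(b') = 0, while b' is interior to [a, b] and right of `P.qM R`, where Z >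
    -- 0.
    have hbb : b ≤ b' := by
      by_contra hbb
      rw [not_le] at hbb
      have h1 := hle b' (by linarith) hbb.le le_rfl b' ⟨by linarith, le_rfl⟩
      rw [h'.right_zero (hb1 hbb)] at h1
      have h2 := h.pos_of_mem_Ioo hR (x := b') ⟨by linarith, hbb⟩ (by linarith)
      linarith
    have hab' : a ∈ Icc a' b' := ⟨hlt.le, by linarith⟩
    have h1 := h'.integral_split hab' ⟨hlt.le.trans h.lt.le, hbb⟩
    -- The strict gain comes from [a', a], which lies left of the Merton ratio for R', so that Z' >
    -- 0 inside.
    have h2 := h'.integral_pos hR' le_rfl hlt hab'.2 (fun hm => by linarith [hm.2])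
    have h3 := h'.integral_nonneg (hlt.le.trans h.lt.le) hbb le_rfl
    have h4 := h.integral_le h' h.lt.le Subset.rfl (Icc_subset_Icc hlt.le hbb)
      (hle b h.lt.le le_rfl hbb)
    linarith
  refine ⟨ha, ?_⟩
  by_contra hlt
  rw [not_le] at hlt
  have hI : Icc a' b' ⊆ Icc a b := Icc_subset_Icc ha hlt.le
  have hle := h.le_of_right_le h' hRR hpos hI Subset.rfl (by
    rw [h'.right_zero (hb1 hlt)]
    exact h.nonneg b' (hI ⟨h'.lt.le, le_rfl⟩))
  have h1 := h.integral_split (c := a') (d := b') ⟨ha, by linarith⟩ ⟨by linarith, hlt.le⟩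
  -- Here [b', b] gives the strict gain: it lies to the right of the Merton ratio for R.
  have h2 := h.integral_pos hR (by linarith) hlt le_rfl (fun hm => by linarith [hm.1])
  have h3 := h.integral_nonneg le_rfl ha (by linarith [h'.lt])
  have h4 := h'.integral_le h h'.lt.le Subset.rfl hI hle
  linarith

/-- Solvency at the purchase boundary. -/
lemma xi_mul_lt (h : P.ReducedSolution R a b n Z) : P.ξ * (a - 1) < a := by
  have ha := h.left_pos
  rcases le_or_gt a 1 with h1 | h1
  · have : 0 ≤ P.ξ := by
      rw [h.integral]
      positivity
    nlinarith
  have hb : 1 < b := h1.trans h.lt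
  have hF : ∀ x ∈ uIcc a b, HasDerivAt (fun q => Real.log (q - 1) - Real.log q)
      (1 / (x - 1) - 1 / x) x := by
    intro x hx
    rw [uIcc_of_le h.lt.le] at hx
    have hx1 : 0 < x - 1 := by linarith [hx.1]
    have hx0 : 0 < x := by linarith
    exact (((hasDerivAt_id x).sub_const 1).log hx1.ne').sub ((hasDerivAt_id x).log hx0.ne')
  have hint : IntervalIntegrable (fun x : ℝ => 1 / (x - 1) - 1 / x) volume a b := by
    refine ContinuousOn.intervalIntegrable fun x hx => ContinuousAt.continuousWithinAt ?_
    rw [uIcc_of_le h.lt.le] at hx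
    have hx1 : x - 1 ≠ 0 := by linarith [hx.1]
    have hx0 : x ≠ 0 := by linarith [hx.1]
    fun_prop (disch := assumption)
  -- For q > 1 the bound 1 + Z(1 - q) > 0 reads Z < 1/(q - 1), so log ξ is at most an explicit
  -- integral, which is below log(a/(a - 1)).
  have hle : ∫ q in a..b, Z q / q ≤ ∫ q in a..b, (1 / (q - 1) - 1 / q) := by
    refine intervalIntegral.integral_mono_on h.lt.le
      (h.intervalIntegrable ⟨le_rfl, h.lt.le⟩ ⟨h.lt.le, le_rfl⟩) hint fun x hx => ?_
    have hx1 : 0 < x - 1 := by linarith [hx.1]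
    have hx0 : 0 < x := by linarith
    have hd := h.dom x hx
    have e : 1 / (x - 1) - 1 / x = (1 / (x - 1)) / x := by
      field_simp
      ring
    rw [e]
    refine div_le_div_of_nonneg_right ?_ hx0.le
    rw [le_div_iff₀ hx1]
    linarith
  rw [intervalIntegral.integral_eq_sub_of_hasDerivAt hF hint] at hle
  have hbl : Real.log (b - 1) < Real.log b := Real.log_lt_log (by linarith) (by linarith)
  have hlt : P.ξ < a / (a - 1) := by
    rw [h.integral, ← Real.exp_log (show 0 < a / (a - 1) from div_pos ha (by linarith)),
      Real.exp_lt_exp, Real.log_div ha.ne' (by linarith)]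
    linarith
  rwa [lt_div_iff₀ (by linarith)] at hlt

end ReducedSolution

/-- Comparison of the optimal boundaries for two coefficients of relative risk aversion. -/
lemma boundaryPair_le {P : Market} (hlam : 0 < P.lam) {R R' : ℝ} (hRR : R' < R)
    (hR : P.AdmissibleR R) (hR' : P.AdmissibleR R') (hsc : P.SufficientCondition R)
    {pl pu pl' pu' : ℝ} (hp : P.IsBoundaryPair R pl pu) (hp' : P.IsBoundaryPair R' pl' pu') :
    pl ≤ pl' ∧ pu ≤ pu' := by
  obtain ⟨a, b, n, hs, rfl, rfl⟩ := hp
  obtain ⟨a', b', n', hs', rfl, rfl⟩ := hp'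
  have h := hs.reduced hlam hR
  have h' := hs'.reduced hlam hR'
  obtain ⟨ha, hb⟩ := h.boundaries_le h' hlam hR'.1 hRR (h.two_add_pos hlam hsc)
  have hu := P.one_le_γup
  have hd := P.one_le_γdn
  have ha0 := h.left_pos
  have hb0 := h.left_pos.trans h.lt
  -- The denominator is a' - γ↑(a' - 1), and for a' > 1 one has γ↑(a' - 1) ≤ ξ(a' - 1) < a'.
  have hden' : 0 < P.γup + (1 - P.γup) * a' := by
    rcases le_or_gt a' 1 with h1 | h1
    · nlinarith
    · have h2 := h'.xi_mul_lt
      rw [ξ] at h2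
      nlinarith [mul_nonneg (mul_nonneg (sub_nonneg.2 hd) (sub_nonneg.2 h1.le))
        (zero_le_one.trans hu)]
  have hden : 0 < P.γup + (1 - P.γup) * a := by nlinarith
  constructor
  · rw [div_le_div_iff₀ hden hden']
    nlinarith
  · rw [div_le_div_iff₀ (by nlinarith) (by nlinarith)]
    nlinarith

end Market

end EpsteinZin

end

open EpsteinZin in
theorem proposition7p3 (P : EpsteinZin.Market) (hlam : 0 < P.lam) :
    -- comparison of two coefficients of relative risk aversion `R' < R`
    (∀ R R' : ℝ, R' < R → P.AdmissibleR R → P.AdmissibleR R' →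
      P.WellPosed R → P.WellPosed R' →
      P.SufficientCondition R → P.SufficientCondition R' →
      ∀ pl pu pl' pu' : ℝ, P.IsBoundaryPair R pl pu → P.IsBoundaryPair R' pl' pu' →
        pl ≤ pl' ∧ pu ≤ pu') ∧
    -- monotonicity in `R`; note that `m(0)` does not depend on `R`
    (P.S < 1 → P.BoundariesDecreaseOn (Set.Ioo 0 1)) ∧
    (1 < P.S → P.BoundariesDecreaseOn {R | 2 ≤ R ∧ 0 < P.m R 0}) ∧
    (1 < P.S → P.σ / 2 ≤ P.lam → P.BoundariesDecreaseOn {R | 1 < R ∧ 0 < P.m R 0}) := by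
  refine ⟨?_, ?_, ?_, ?_⟩
  · intro R R' hRR hR hR' _ _ hsc _ pl pu pl' pu' hp hp'
    exact Market.boundaryPair_le hlam hRR hR hR' hsc hp hp'
  · intro hS R₁ _ R₂ _ hRR hR₁ hR₂ _ _ pl₁ pu₁ pl₂ pu₂ hp₁ hp₂
    exact Market.boundaryPair_le hlam hRR hR₂ hR₁ (Or.inl hS) hp₂ hp₁
  · intro hS R₁ _ R₂ hA hRR hR₁ hR₂ _ _ pl₁ pu₁ pl₂ pu₂ hp₁ hp₂
    exact Market.boundaryPair_le hlam hRR hR₂ hR₁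
      (Or.inr ⟨hS, hA.2, Or.inr (Or.inl hA.1)⟩) hp₂ hp₁
  · intro hS hlσ R₁ _ R₂ hA hRR hR₁ hR₂ _ _ pl₁ pu₁ pl₂ pu₂ hp₁ hp₂
    refine Market.boundaryPair_le hlam hRR hR₂ hR₁
      (Or.inr ⟨hS, hA.2, Or.inr (Or.inr ?_)⟩) hp₂ hp₁
    -- ℓ'(0) = -κσ(λ - σ/2) with κ < 0, so λ ≥ σ/2 gives condition (iii).
    rw [Market.deriv_ell_zero]
    have h1 := mul_nonneg P.σ_pos.le (sub_nonneg.2 hlσ)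
    have h2 := mul_nonneg_of_nonpos_of_nonpos (Market.kap_neg hS).le (neg_nonpos.2 h1)
    linarith
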